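/- Let $(W,S)$ be a Coxeter system with $S$ finite, and let $(V,B)$ be a real vector space with a symmetric bilinear form. For $\alpha\in V$ with $B(\alpha,\alpha)\neq 0$ let $s_\alpha(v)=v-2\frac{B(\alpha,v)}{B(\alpha,\alpha)}\alpha$. Fix a geometric representation of $(W,S)$ in $(V,B)$, that is, a faithful representation of $W$ by linear maps preserving $B$ in which each $s\in S$ acts as $s_{\alpha_s}$, where $\Delta=\{\alpha_s\mid s\in S\}$ is a simple system: $\sum_{s} c_s\alpha_s=0$ with all $c_s\ge 0$ implies that all $c_s=0$; $B(\alpha_s,\alpha_t)\in\,]-\infty,-1]\cup\{-\cos(\pi/k)\mid k\in\mathbb N_{\ge 2}\}$ for $s\ne t$; and $B(\alpha_s,\alpha_s)=1$ for all $s$. Let $\Phi=W(\Delta)$ be the root system, $\Phi^+=\Phi\cap\operatorname{cone}(\Delta)$ the set of positive roots, where $\operatorname{cone}(A)$ is the set of non-negative linear combinations of elements of $A$, and $\Phi^-=-\Phi^+$, so that $\Phi=\Phi^+\sqcup\Phi^-$. Put $N(w)=\Phi^+\cap w(\Phi^-)$. Let $X$ be an order coideal of $\mathbb R^+=\{\lambda\in\mathbb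 R\mid\lambda>0\}$, i.e. $X\subseteq\mathbb R^+$, and $x\in X$, $y\ge x$ imply $y\in X$. The $X$-length $d_X:\Phi\to\mathbb Z$ is defined by $d_X(\pm\beta)=\pm|\{\alpha\in N(s_\beta)\mid B(\alpha,\beta)\in X\}|$ for $\beta\in\Phi^+$. The Bruhat order $\le'$ on $\Phi$ is the reflexive transitive closure of the relation $\lessdot'$, where $\alpha\lessdot'\beta$ means that $\beta=s_\gamma(\alpha)$ for some $\gamma\in\Phi^+$ with $B(\gamma,\alpha)<0$. Let $W'$ be a reflection subgroup of $W$, i.e. a subgroup generated by $\{s_\beta\mid\beta\in A\}$ for some $A\subseteq\Phi^+$. Let $\Phi_{W'}=\{\beta\in\Phi\mid s_\beta\in W'\}$, a root system with canonical simple system $\Delta_{W'}=\{\alpha\in\Phi^+\mid N(s_\alpha)\cap\Phi_{W'}=\{\alpha\}\}$, and let $\Phi_{W'}^+$, $d_{W',X}$ and $\le'_{W'}$ be attached to $(\Phi_{W'},\Delta_{W'})$ in the same way as $\Phi^+$, $d_X$ and $\le'$ are attached to $(\Phi,\Delta)$. Then: 1. If $\beta,\beta'\in\Phi$ and $\beta\le'\beta'$,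 then $d_X(\beta)\le d_X(\beta')$. 2. If $\beta,\beta'\in\Phi_{W'}$ and $\beta\le'_{W'}\beta'$, then $\beta\le'\beta'$ and $$0\le d_{W',X}(\beta')-d_{W',X}(\beta)\le d_X(\beta')-d_X(\beta).$$ 3. If $\beta'\in\Phi_{W'}^+$, then $0\le d_{W',X}(\beta')\le d_X(\beta')$. -/

import Mathlib

/-! Geometric representations of Coxeter systems, based root systems, `X`-length and the Bruhat
order on roots, and reflection subgroups. -/

section BasedRootSystem

variable {V : Type*} [AddCommGroup V] [Module ℝ V]

/-- The `B`-reflection `s_α : v ↦ v - 2 (B(α, v) / B(α, α)) α`. -/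
noncomputable def bReflection (B : LinearMap.BilinForm ℝ V) (α : V) : V →ₗ[ℝ] V :=
  LinearMap.id - (2 / B α α) • (B α).smulRight α

theorem bReflection_apply (B : LinearMap.BilinForm ℝ V) (α v : V) :
    bReflection B α v = v - (2 * (B α v / B α α)) • α := by
  simp only [bReflection, LinearMap.sub_apply, LinearMap.id_apply, LinearMap.smul_apply,
    LinearMap.smulRight_apply, smul_smul]
  congr 2
  ring

/-- The vectors `α i` are the distinct elements of a simple system in `(V, B)`. (Distinctness
follows from `off_diag` and `diag`; a simple system is moreover finite, which is the hypothesis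
`[Finite I]` on the index type below.) -/
structure IsSimpleSystem {I : Type*} (B : LinearMap.BilinForm ℝ V) (α : I → V) : Prop where
  /-- positive linear independence -/
  pos_indep : ∀ c : I →₀ ℝ, (∀ i, 0 ≤ c i) → (c.sum fun i r => r • α i) = 0 → c = 0
  off_diag : ∀ i j, i ≠ j →
    B (α i) (α j) ≤ -1 ∨ ∃ k : ℕ, 2 ≤ k ∧ B (α i) (α j) = -Real.cos (Real.pi / k)
  diag : ∀ i, B (α i) (α i) = 1

/-- The positive roots `Φ⁺ = cone(Δ) ∩ Φ` of a root system `Φ` with base `Δ`. -/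
def posRoots (Φ Δ : Set V) : Set V := {β | β ∈ Φ ∧ β ∈ PointedCone.hull ℝ Δ}

/-- The negative roots `Φ⁻ = -Φ⁺`. -/
def negRoots (Φ Δ : Set V) : Set V := {β | -β ∈ posRoots Φ Δ}

/-- The inversion set `N(w) = Φ⁺ ∩ w(Φ⁻)` of a linear map `w`. -/
def inversionSet (Φ Δ : Set V) (w : V →ₗ[ℝ] V) : Set V := posRoots Φ Δ ∩ w '' negRoots Φ Δ

open Classical in
/-- The `X`-length `d_X : Φ → ℤ` attached to `(Φ, Δ, X)`:
`d_X(±β) = ± |{α ∈ N(s_β) | B(α, β) ∈ X}|` for `β ∈ Φ⁺`.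
(Only its values at elements of `Φ = Φ⁺ ⊔ -Φ⁺` are meaningful.) -/
noncomputable def xLength (B : LinearMap.BilinForm ℝ V) (Φ Δ : Set V) (X : Set ℝ) (β : V) : ℤ :=
  if β ∈ posRoots Φ Δ then
    (({α | α ∈ inversionSet Φ Δ (bReflection B β) ∧ B α β ∈ X} : Set V).ncard : ℤ)
  else
    -(({α | α ∈ inversionSet Φ Δ (bReflection B (-β)) ∧ B α (-β) ∈ X} : Set V).ncard : ℤ)

/-- The relation `α ⋖' β` on `Φ`: `β = s_γ(α)` for some `γ ∈ Φ⁺` with `B(γ, α) < 0`. -/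
def BruhatStep (B : LinearMap.BilinForm ℝ V) (Φ Δ : Set V) (α β : V) : Prop :=
  α ∈ Φ ∧ β ∈ Φ ∧ ∃ γ ∈ posRoots Φ Δ, B γ α < 0 ∧ β = bReflection B γ α

/-- The Bruhat order `≤'` on `Φ`: the reflexive transitive closure of `⋖'`. -/
def BruhatLE (B : LinearMap.BilinForm ℝ V) (Φ Δ : Set V) : V → V → Prop :=
  Relation.ReflTransGen (BruhatStep B Φ Δ)

end BasedRootSystem

/-- The order coideals (upper sets) of `ℝ⁺ = {λ ∈ ℝ | λ > 0}`, as sets of reals. -/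
def IsOrderCoideal (X : Set ℝ) : Prop := X ⊆ Set.Ioi 0 ∧ ∀ x ∈ X, ∀ y, x ≤ y → y ∈ X

/-- A geometric representation of a Coxeter system `(W, S)` in `(V, B)`: a faithful representation
of `W` by linear maps preserving the symmetric bilinear form `B`, such that each simple reflection
acts as the `B`-reflection in the corresponding vector of a simple system. -/
structure GeometricRepresentation {I W : Type*} [Group W] {M : CoxeterMatrix I}
    (cs : CoxeterSystem M W) (V : Type*) [AddCommGroup V] [Module ℝ V] where
  /-- the bilinear form `B` -/
  form : LinearMap.BilinForm ℝ V
  form_symm : ∀ x y, form x y = form y x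
  /-- the simple root `α_s` of a simple reflection `s` -/
  simpleRoot : I → V
  isSimpleSystem : IsSimpleSystem form simpleRoot
  /-- the action of `W` on `V` -/
  rep : Representation ℝ W V
  faithful : Function.Injective rep
  isometry : ∀ w x y, form (rep w x) (rep w y) = form x y
  rep_simple : ∀ i, rep (cs.simple i) = bReflection form (simpleRoot i)

namespace GeometricRepresentation

variable {I W V : Type*} [Group W] {M : CoxeterMatrix I} {cs : CoxeterSystem M W}
  [AddCommGroup V] [Module ℝ V] (ρ : GeometricRepresentation cs V)

/-- The simple system `Δ`. -/
def simples : Set V := Set.range ρ.simpleRoot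

/-- The root system `Φ = W(Δ)`. -/
def roots : Set V := {β | ∃ w : W, ∃ α ∈ ρ.simples, ρ.rep w α = β}

/-- `W'` is a reflection subgroup: it is generated by the reflections `s_β`, `β ∈ A`, for some
`A ⊆ Φ⁺`. -/
def IsReflectionSubgroup (W' : Subgroup W) : Prop :=
  ∃ A ⊆ posRoots ρ.roots ρ.simples,
    W' = Subgroup.closure {t | ∃ β ∈ A, ρ.rep t = bReflection ρ.form β}

/-- `Φ_{W'} = {β ∈ Φ | s_β ∈ W'}`. -/
def subRoots (W' : Subgroup W) : Set V :=
  {β | β ∈ ρ.roots ∧ ∃ t ∈ W', ρ.rep t = bReflection ρ.form β}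

/-- The canonical simple system `Δ_{W'} = {α ∈ Φ⁺ | N(s_α) ∩ Φ_{W'} = {α}}` of `Φ_{W'}`. -/
def subSimples (W' : Subgroup W) : Set V :=
  {α | α ∈ posRoots ρ.roots ρ.simples ∧
    inversionSet ρ.roots ρ.simples (bReflection ρ.form α) ∩ ρ.subRoots W' = {α}}

end GeometricRepresentation

/-! ### Reflections in unit vectors. -/

section Reflections

variable {V : Type*} [AddCommGroup V] [Module ℝ V] {B : LinearMap.BilinForm ℝ V}

/-! Let `f` be the odd function `[b ∈ X] - [-b ∈ X]`, monotone because `X` is an upper set of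
positive reals. Everything follows from one identity for roots `γ`, `α` (`xLength_bReflection_sub`):
`d_X(s_γ α) - d_X(α) = ∑ (f(B(δ, s_γ α)) - f(B(δ, α)))`, summed over `δ ∈ N(s_γ)`. If `γ > 0` and
`B(γ, α) < 0`, each term is nonnegative, since `B(δ, s_γ α) = B(δ, α) - 2 B(γ, α) B(δ, γ)` and
inversions satisfy `B(δ, γ) > 0`. This gives monotonicity. For a subsystem the same sum runs over a
subset of `N(s_γ)`, which gives the comparison of differences.

The identity comes from `signChangeSum`, `S_w(α) = ∑ f(B(δ, α)) (sgn δ - sgn wδ)` over all roots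
`δ`. It obeys a cocycle rule (`signChangeSum_comp`), and `S_{s_α}(α) = 4 d_X(α)`
(`four_mul_xLength`); expand `s_{s_γ α} = s_γ s_α s_γ`.

It remains to verify the axioms `IsSignedRootSystem`. For `Φ`, the sign dichotomy rests on
`rep_simpleRoot_mem_hull`, proved by reduction to rank two, and finiteness on `finite_inversions`.
For `Φ_{W'}`, `mem_hull_canonicalSimples` shows that its positive roots are exactly those positive
in `Φ`. -/

theorem bReflection_apply_of_unit {γ : V} (hγ : B γ γ = 1) (v : V) :
    bReflection B γ v = v - (2 * B γ v) • γ := by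
  rw [bReflection_apply, hγ, div_one]

theorem bReflection_self {γ : V} (hγ : B γ γ = 1) : bReflection B γ γ = -γ := by
  rw [bReflection_apply_of_unit hγ, hγ]
  module

theorem bReflection_bReflection {γ : V} (hγ : B γ γ = 1) (v : V) :
    bReflection B γ (bReflection B γ v) = v := by
  simp only [bReflection_apply_of_unit hγ, map_sub, map_smul, hγ, smul_eq_mul]
  module

theorem bReflection_neg (γ : V) : bReflection B (-γ) = bReflection B γ := by
  ext v
  simp [bReflection_apply, neg_div]

theorem bReflection_isometry (hB : ∀ x y, B x y = B y x) {γ : V} (hγ : B γ γ = 1) (v w : V) :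
    B (bReflection B γ v) (bReflection B γ w) = B v w := by
  simp only [bReflection_apply_of_unit hγ, map_sub, map_smul, LinearMap.sub_apply,
    LinearMap.smul_apply, smul_eq_mul, hγ]
  rw [hB v γ]
  ring

theorem bReflection_conj (hB : ∀ x y, B x y = B y x) {γ α : V} (hγ : B γ γ = 1)
    (hα : B α α = 1) (v : V) :
    bReflection B (bReflection B γ α) v =
      bReflection B γ (bReflection B α (bReflection B γ v)) := by
  have h1 : B (bReflection B γ α) (bReflection B γ α) = 1 := by
    rw [bReflection_isometry hB hγ, hα]
  have h2 : B (bReflection B γ α) v = B α (bReflection B γ v) := by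
    rw [← bReflection_isometry hB hγ, bReflection_bReflection hγ]
  rw [bReflection_apply_of_unit h1, h2, bReflection_apply_of_unit hα, map_sub, map_smul,
    bReflection_bReflection hγ]

end Reflections

/-! ### Signed root systems and the change of `X`-length under a reflection. -/

section SignedRootSystem

variable {V : Type*} [AddCommGroup V] [Module ℝ V]

/-- A set of unit vectors, stable under its reflections, that is the disjoint union of its
positive and its negative elements, such that each reflection has finitely many inversions. -/
structure IsSignedRootSystem (B : LinearMap.BilinForm ℝ V) (Φ Δ : Set V) : Prop where
  symm : ∀ x y, B x y = B y x
  norm : ∀ β ∈ Φ, B β β = 1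
  pos_or_neg : ∀ β ∈ Φ, β ∈ posRoots Φ Δ ∨ -β ∈ posRoots Φ Δ
  not_neg : ∀ β ∈ posRoots Φ Δ, -β ∉ posRoots Φ Δ
  refl_mem : ∀ γ ∈ Φ, ∀ β ∈ Φ, bReflection B γ β ∈ Φ
  finite : ∀ γ ∈ Φ, (inversionSet Φ Δ (bReflection B γ)).Finite

theorem mem_inversionSet_bReflection {B : LinearMap.BilinForm ℝ V} {Φ Δ : Set V} {γ : V}
    (hγ : B γ γ = 1) {δ : V} :
    δ ∈ inversionSet Φ Δ (bReflection B γ) ↔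
      δ ∈ posRoots Φ Δ ∧ -bReflection B γ δ ∈ posRoots Φ Δ := by
  refine and_congr_right fun _ => ⟨?_, fun h => ⟨_, h, bReflection_bReflection hγ δ⟩⟩
  rintro ⟨ε, hε, rfl⟩
  rwa [bReflection_bReflection hγ]

open Classical in
/-- The sign of a root. -/
noncomputable def rootSign (Φ Δ : Set V) (β : V) : ℤ := if β ∈ posRoots Φ Δ then 1 else -1

open Classical in
/-- The odd step function `b ↦ [b ∈ X] - [-b ∈ X]`. -/
noncomputable def oddIndicator (X : Set ℝ) (b : ℝ) : ℤ :=
  (if b ∈ X then 1 else 0) - (if -b ∈ X then 1 else 0)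

theorem oddIndicator_neg (X : Set ℝ) (b : ℝ) : oddIndicator X (-b) = -oddIndicator X b := by
  rw [oddIndicator, oddIndicator, neg_neg, neg_sub]

theorem oddIndicator_mono {X : Set ℝ} (hX : IsOrderCoideal X) : Monotone (oddIndicator X) := by
  intro a b hab
  have h1 := fun h => hX.2 a h b hab
  have h2 := fun h => hX.2 (-b) h (-a) (neg_le_neg hab)
  unfold oddIndicator
  split_ifs <;> simp_all

open Classical in
theorem oddIndicator_of_pos {X : Set ℝ} (hX : IsOrderCoideal X) {b : ℝ} (hb : 0 < b) :
    oddIndicator X b = if b ∈ X then 1 else 0 := by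
  have : -b ∉ X := fun h => by
    have : (0 : ℝ) < -b := hX.1 h
    linarith
  simp [oddIndicator, this]

/-- The sum over all roots `δ` of `oddIndicator X (B δ α)`, weighted by the change of sign of `δ`
under `w`. -/
noncomputable def signChangeSum (B : LinearMap.BilinForm ℝ V) (Φ Δ : Set V) (X : Set ℝ)
    (w : V → V) (α : V) : ℤ :=
  ∑ᶠ δ ∈ Φ, oddIndicator X (B δ α) * (rootSign Φ Δ δ - rootSign Φ Δ (w δ))

namespace IsSignedRootSystem

variable {B : LinearMap.BilinForm ℝ V} {Φ Δ : Set V} (h : IsSignedRootSystem B Φ Δ)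

include h

theorem neg_mem {β : V} (hβ : β ∈ Φ) : -β ∈ Φ := by
  rw [← bReflection_self (h.norm β hβ)]
  exact h.refl_mem β hβ β hβ

theorem rootSign_neg {β : V} (hβ : β ∈ Φ) : rootSign Φ Δ (-β) = -rootSign Φ Δ β := by
  unfold rootSign
  rcases h.pos_or_neg β hβ with h1 | h1
  · simp [h1, h.not_neg β h1]
  · have := h.not_neg _ h1
    rw [neg_neg] at this
    simp [h1, this]

/-- Inversions of `s_γ`, for `γ` positive, have positive product with `γ`. -/
theorem form_pos_of_mem_inversionSet {γ δ : V} (hγ : γ ∈ posRoots Φ Δ)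
    (hδ : δ ∈ inversionSet Φ Δ (bReflection B γ)) : 0 < B δ γ := by
  have hγ1 := h.norm γ hγ.1
  rw [mem_inversionSet_bReflection hγ1] at hδ
  by_contra! hle
  refine h.not_neg _ hδ.2 ?_
  rw [neg_neg]
  refine ⟨h.refl_mem _ hγ.1 _ hδ.1.1, ?_⟩
  rw [bReflection_apply_of_unit hγ1, sub_eq_add_neg, ← neg_smul]
  refine add_mem hδ.1.2 (PointedCone.smul_mem _ ?_ hγ.2)
  rw [h.symm]
  linarith

theorem mem_inversionSet_of_rootSign_ne {γ δ : V} (hγ : γ ∈ Φ) (hδ : δ ∈ Φ)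
    (hne : rootSign Φ Δ δ ≠ rootSign Φ Δ (bReflection B γ δ)) :
    δ ∈ inversionSet Φ Δ (bReflection B γ) ∪ -inversionSet Φ Δ (bReflection B γ) := by
  have hr := h.refl_mem γ hγ δ hδ
  rw [Set.mem_union, Set.mem_neg, mem_inversionSet_bReflection (h.norm γ hγ),
    mem_inversionSet_bReflection (h.norm γ hγ), map_neg, neg_neg]
  unfold rootSign at hne
  rcases h.pos_or_neg δ hδ with h1 | h1 <;>
    rcases h.pos_or_neg _ hr with h2 | h2
  · simp [h1, h2] at hne
  · exact .inl ⟨h1, h2⟩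
  · exact .inr ⟨h1, h2⟩
  · have e1 := h.not_neg _ h1
    have e2 := h.not_neg _ h2
    rw [neg_neg] at e1 e2
    simp [e1, e2] at hne

theorem finite_rootSign_ne {γ : V} (hγ : γ ∈ Φ) :
    {δ | δ ∈ Φ ∧ rootSign Φ Δ δ ≠ rootSign Φ Δ (bReflection B γ δ)}.Finite :=
  ((h.finite γ hγ).union (h.finite γ hγ).neg).subset fun _ hδ =>
    h.mem_inversionSet_of_rootSign_ne hγ hδ.1 hδ.2

/-- The sign change telescopes through `s_γ δ`, and the second half is reindexed by the isometry
`s_γ`. The finiteness of `hw` is needed because a `finsum` with infinite support is `0` and need not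
be additive. -/
theorem signChangeSum_comp (X : Set ℝ) {γ : V} (hγ : γ ∈ Φ) {w : V → V}
    (hw : {δ | δ ∈ Φ ∧ rootSign Φ Δ δ ≠ rootSign Φ Δ (w δ)}.Finite) (α : V) :
    signChangeSum B Φ Δ X (w ∘ bReflection B γ) α =
      signChangeSum B Φ Δ X (bReflection B γ) α +
        signChangeSum B Φ Δ X w (bReflection B γ α) := by
  have hγ1 := h.norm γ hγ
  set r := bReflection B γ
  have hbij : Set.BijOn r Φ Φ := by
    refine ⟨fun δ hδ => h.refl_mem γ hγ δ hδ, ?_, fun δ hδ => ?_⟩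
    · exact (Function.LeftInverse.injective (bReflection_bReflection hγ1)).injOn
    · exact ⟨r δ, h.refl_mem γ hγ δ hδ, bReflection_bReflection hγ1 δ⟩
  have hre : signChangeSum B Φ Δ X w (r α) =
      ∑ᶠ δ ∈ Φ, oddIndicator X (B δ α) * (rootSign Φ Δ (r δ) - rootSign Φ Δ (w (r δ))) := by
    refine (finsum_mem_eq_of_bijOn r hbij fun δ _ => ?_).symm
    rw [bReflection_isometry h.symm hγ1]
  have hfin1 : (Φ ∩ Function.support fun δ =>
      oddIndicator X (B δ α) * (rootSign Φ Δ δ - rootSign Φ Δ (r δ))).Finite := by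
    refine (h.finite_rootSign_ne hγ).subset fun δ hδ => ⟨hδ.1, fun he => hδ.2 ?_⟩
    simp only [r, he, sub_self, mul_zero]
  have hfin2 : (Φ ∩ Function.support fun δ =>
      oddIndicator X (B δ α) * (rootSign Φ Δ (r δ) - rootSign Φ Δ (w (r δ)))).Finite := by
    refine (hw.image r).subset fun δ hδ => ⟨r δ, ⟨hbij.1 hδ.1, fun he => hδ.2 ?_⟩, ?_⟩
    · simp only [he, sub_self, mul_zero]
    · exact bReflection_bReflection hγ1 δ
  rw [hre, signChangeSum, signChangeSum, ← finsum_mem_add_distrib' hfin1 hfin2]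
  refine finsum_mem_congr rfl fun δ _ => ?_
  simp only [Function.comp]
  ring

/-- Only the inversions of `s_γ` and their negatives change sign. The sign difference is `2` on an
inversion, and the summand is even in `δ`, being a product of two odd factors; hence `4`. -/
theorem signChangeSum_bReflection (X : Set ℝ) {γ : V} (hγ : γ ∈ Φ) (α : V) :
    signChangeSum B Φ Δ X (bReflection B γ) α =
      4 * ∑ δ ∈ (h.finite γ hγ).toFinset, oddIndicator X (B δ α) := by
  set r := bReflection B γ
  set N := inversionSet Φ Δ r
  have hγ1 := h.norm γ hγ
  have hmem : ∀ {δ}, δ ∈ N ↔ δ ∈ posRoots Φ Δ ∧ -r δ ∈ posRoots Φ Δ :=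
    mem_inversionSet_bReflection hγ1
  set e : V → ℤ := fun δ => oddIndicator X (B δ α) * (rootSign Φ Δ δ - rootSign Φ Δ (r δ))
  have hval : ∀ δ ∈ N, e δ = 2 * oddIndicator X (B δ α) := by
    intro δ hδ
    have h1 := (hmem.1 hδ).1
    have h2 := h.not_neg _ (hmem.1 hδ).2
    rw [neg_neg] at h2
    simp only [e, rootSign, h1, h2, if_true, if_false]
    ring
  have hneg : ∀ δ ∈ Φ, e (-δ) = e δ := by
    intro δ hδ
    simp only [e, map_neg, LinearMap.neg_apply, oddIndicator_neg, h.rootSign_neg hδ,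
      h.rootSign_neg (h.refl_mem γ hγ δ hδ), r]
    ring
  have hN : N ⊆ Φ := fun δ hδ => (hmem.1 hδ).1.1
  have hsub : N ∪ -N ⊆ Φ := Set.union_subset hN fun δ hδ => by
    simpa using h.neg_mem (hN hδ)
  have hdisj : Disjoint N (-N) := Set.disjoint_left.2 fun δ h1 h2 =>
    h.not_neg _ (hmem.1 h1).1 (hmem.1 h2).1
  have hsupp : ∑ᶠ δ ∈ Φ, e δ = ∑ᶠ δ ∈ N ∪ -N, e δ := by
    refine finsum_mem_inter_support_eq _ _ _ (Set.ext fun δ => and_congr_left fun hδ => ?_)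
    refine ⟨fun hΦ => h.mem_inversionSet_of_rootSign_ne hγ hΦ fun he => hδ ?_, fun hδ => hsub hδ⟩
    simp only [e, r, he, sub_self, mul_zero]
  have hNn : ∑ᶠ δ ∈ -N, e δ = ∑ᶠ δ ∈ N, e δ := by
    refine finsum_mem_eq_of_bijOn (fun δ => -δ) ⟨fun δ hδ => hδ, neg_injective.injOn, ?_⟩ ?_
    · exact fun δ hδ => ⟨-δ, by simpa using hδ, neg_neg δ⟩
    · intro δ hδ
      rw [← hneg _ (hN hδ), neg_neg]
  rw [signChangeSum, hsupp, finsum_mem_union hdisj (h.finite γ hγ) (h.finite γ hγ).neg, hNn,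
    finsum_mem_congr rfl hval, finsum_mem_eq_finite_toFinset_sum _ (h.finite γ hγ),
    ← Finset.mul_sum]
  ring

theorem ncard_eq_sum_oddIndicator {X : Set ℝ} (hX : IsOrderCoideal X) {β : V}
    (hβ : β ∈ posRoots Φ Δ) :
    (({δ | δ ∈ inversionSet Φ Δ (bReflection B β) ∧ B δ β ∈ X} : Set V).ncard : ℤ) =
      ∑ δ ∈ (h.finite β hβ.1).toFinset, oddIndicator X (B δ β) := by
  classical
  have hset : ({δ | δ ∈ inversionSet Φ Δ (bReflection B β) ∧ B δ β ∈ X} : Set V) =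
      ((h.finite β hβ.1).toFinset.filter fun δ => B δ β ∈ X) := by
    ext δ
    simp
  rw [hset, Set.ncard_coe_finset, ← Finset.sum_boole]
  refine Finset.sum_congr rfl fun δ hδ => ?_
  rw [oddIndicator_of_pos hX (h.form_pos_of_mem_inversionSet hβ (by simpa using hδ))]

/-- Removes the case split on the sign of `α`: inversions of `s_α` pair positively with the positive
one of `±α`, so `oddIndicator` counts membership in `X` there, and its oddness supplies the sign for
negative `α`. -/
theorem four_mul_xLength {X : Set ℝ} (hX : IsOrderCoideal X) {α : V} (hα : α ∈ Φ) :
    4 * xLength B Φ Δ X α = signChangeSum B Φ Δ X (bReflection B α) α := by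
  rw [h.signChangeSum_bReflection X hα, xLength]
  split_ifs with hpos
  · rw [h.ncard_eq_sum_oddIndicator hX hpos]
  · have hneg := (h.pos_or_neg α hα).resolve_left hpos
    rw [h.ncard_eq_sum_oddIndicator hX hneg, ← Finset.sum_neg_distrib]
    congr 1
    simp only [bReflection_neg, map_neg, oddIndicator_neg, neg_neg]

/-- The change of the `X`-length under a reflection, as a sum over the inversions of the
reflection. -/
theorem xLength_bReflection_sub {X : Set ℝ} (hX : IsOrderCoideal X) {γ α : V} (hγ : γ ∈ Φ)
    (hα : α ∈ Φ) :
    xLength B Φ Δ X (bReflection B γ α) - xLength B Φ Δ X α =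
      ∑ δ ∈ (h.finite γ hγ).toFinset,
        (oddIndicator X (B δ (bReflection B γ α)) - oddIndicator X (B δ α)) := by
  have hγ1 := h.norm γ hγ
  have hα1 := h.norm α hα
  have hβ := h.refl_mem γ hγ α hα
  have hcomp : (bReflection B (bReflection B γ α) : V → V) =
      (bReflection B γ ∘ bReflection B α) ∘ bReflection B γ :=
    funext fun v => bReflection_conj h.symm hγ1 hα1 v
  have hfin : {δ | δ ∈ Φ ∧ rootSign Φ Δ δ ≠
      rootSign Φ Δ ((bReflection B γ ∘ bReflection B α) δ)}.Finite := by
    refine ((h.finite_rootSign_ne hα).union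
      ((h.finite_rootSign_ne hγ).image (bReflection B α))).subset fun δ hδ => ?_
    by_cases he : rootSign Φ Δ δ = rootSign Φ Δ (bReflection B α δ)
    · exact .inr ⟨bReflection B α δ, ⟨h.refl_mem α hα δ hδ.1, he ▸ hδ.2⟩,
        bReflection_bReflection hα1 δ⟩
    · exact .inl ⟨hδ.1, he⟩
  have h1 := h.four_mul_xLength hX hα
  have h2 := h.four_mul_xLength hX hβ
  -- Peeling `s_γ s_α s_γ` from the right evaluates the three factors at `s_γ α`, `α` and `s_α α =
  -- -α`.
  rw [hcomp, h.signChangeSum_comp X hγ hfin, bReflection_bReflection hγ1,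
    h.signChangeSum_comp X hα (h.finite_rootSign_ne hγ), bReflection_self hα1,
    h.signChangeSum_bReflection X hγ, h.signChangeSum_bReflection X hγ, ← h1] at h2
  simp only [map_neg, oddIndicator_neg, Finset.sum_neg_distrib] at h2
  rw [Finset.sum_sub_distrib]
  linarith

theorem oddIndicator_sub_nonneg {X : Set ℝ} (hX : IsOrderCoideal X) {γ α δ : V}
    (hγ : γ ∈ posRoots Φ Δ) (hγα : B γ α < 0)
    (hδ : δ ∈ inversionSet Φ Δ (bReflection B γ)) :
    0 ≤ oddIndicator X (B δ (bReflection B γ α)) - oddIndicator X (B δ α) := by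
  rw [sub_nonneg]
  refine oddIndicator_mono hX ?_
  rw [bReflection_apply_of_unit (h.norm γ hγ.1), map_sub, map_smul, smul_eq_mul]
  nlinarith [h.form_pos_of_mem_inversionSet hγ hδ]

theorem xLength_le_of_bruhatLE {X : Set ℝ} (hX : IsOrderCoideal X) {β β' : V}
    (hle : BruhatLE B Φ Δ β β') : xLength B Φ Δ X β ≤ xLength B Φ Δ X β' := by
  induction hle with
  | refl => exact le_rfl
  | tail _ hstep ih =>
    obtain ⟨hα, -, γ, hγ, hneg, rfl⟩ := hstep
    refine ih.trans ?_
    rw [← sub_nonneg, h.xLength_bReflection_sub hX hγ.1 hα]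
    exact Finset.sum_nonneg fun δ hδ =>
      h.oddIndicator_sub_nonneg hX hγ hneg (by simpa using hδ)

theorem inversionSet_subset {Ψ Γ : Set V} (hsub : posRoots Φ Δ ⊆ posRoots Ψ Γ) {γ : V}
    (hγ : γ ∈ Φ) :
    inversionSet Φ Δ (bReflection B γ) ⊆ inversionSet Ψ Γ (bReflection B γ) := by
  intro δ hδ
  have h1 := h.norm γ hγ
  rw [mem_inversionSet_bReflection h1] at hδ ⊢
  exact ⟨hsub hδ.1, hsub hδ.2⟩

/-! ### Comparison with a subsystem having compatible positive roots. -/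

section Sub

variable {Ψ Γ : Set V} (h' : IsSignedRootSystem B Ψ Γ) (hsub : posRoots Ψ Γ ⊆ posRoots Φ Δ)

include h' hsub

theorem subset_of_posRoots_subset : Ψ ⊆ Φ := by
  intro β hβ
  rcases h'.pos_or_neg β hβ with hp | hp
  · exact (hsub hp).1
  · simpa using h.neg_mem (hsub hp).1

theorem bruhatLE_of_sub {β β' : V} (hle : BruhatLE B Ψ Γ β β') : BruhatLE B Φ Δ β β' := by
  have hΨ := h.subset_of_posRoots_subset h' hsub
  refine Relation.ReflTransGen.mono ?_ _ _ hle
  rintro α β ⟨hα, hβ, γ, hγ, hstep⟩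
  exact ⟨hΨ hα, hΨ hβ, γ, hsub hγ, hstep⟩

theorem xLength_sub_le_of_bruhatLE {X : Set ℝ} (hX : IsOrderCoideal X) {β β' : V}
    (hle : BruhatLE B Ψ Γ β β') :
    xLength B Ψ Γ X β' - xLength B Ψ Γ X β ≤ xLength B Φ Δ X β' - xLength B Φ Δ X β := by
  induction hle with
  | refl => simp
  | @tail α _ _ hstep ih =>
    obtain ⟨hα, -, γ, hγ, hneg, rfl⟩ := hstep
    have hΨ := h.subset_of_posRoots_subset h' hsub
    suffices xLength B Ψ Γ X (bReflection B γ α) - xLength B Ψ Γ X α ≤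
        xLength B Φ Δ X (bReflection B γ α) - xLength B Φ Δ X α by linarith
    rw [h.xLength_bReflection_sub hX (hΨ hγ.1) (hΨ hα), h'.xLength_bReflection_sub hX hγ.1 hα]
    -- Both differences sum the same terms; the larger system only adds nonnegative ones.
    refine Finset.sum_le_sum_of_subset_of_nonneg ?_ fun δ hδ _ =>
      h.oddIndicator_sub_nonneg hX (hsub hγ) hneg (by simpa using hδ)
    simpa using h'.inversionSet_subset hsub hγ.1

theorem xLength_le_of_mem_posRoots (X : Set ℝ) {β : V} (hβ : β ∈ posRoots Ψ Γ) :
    0 ≤ xLength B Ψ Γ X β ∧ xLength B Ψ Γ X β ≤ xLength B Φ Δ X β := by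
  rw [xLength, xLength, if_pos hβ, if_pos (hsub hβ)]
  refine ⟨Nat.cast_nonneg _, Nat.cast_le.2 (Set.ncard_le_ncard ?_ ?_)⟩
  · exact fun δ hδ => ⟨h'.inversionSet_subset hsub hβ.1 hδ.1, hδ.2⟩
  · exact (h.finite β (hsub hβ).1).subset fun δ hδ => hδ.1

end Sub

end IsSignedRootSystem

end SignedRootSystem

/-! ### Rank two: alternating words and Chebyshev coefficients. -/

section Alternating

/-- The alternating product `x * y * x * ⋯` with `n` factors. -/
def altProd {G : Type*} [Monoid G] : G → G → ℕ → G
  | _, _, 0 => 1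
  | x, y, n + 1 => x * altProd y x n

theorem altProd_two_mul {G : Type*} [Monoid G] (x y : G) (k : ℕ) :
    altProd x y (2 * k) = (x * y) ^ k := by
  induction k with
  | zero => simp [altProd]
  | succ k ih =>
    rw [show 2 * (k + 1) = 2 * k + 1 + 1 from rfl, altProd, altProd, ih, pow_succ', mul_assoc]

/-- Inverting reverses an alternating word of involutions, and its new last letter `x` is followed
by `y`. The parity of `n` decides the first letter, hence the disjunction. -/
theorem altProd_inv_mul {G : Type*} [Group G] {x y : G} (hx : x * x = 1) (hy : y * y = 1)
    (n m : ℕ) :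
    (altProd x y n)⁻¹ * altProd y x m = altProd x y (n + m) ∨
      (altProd x y n)⁻¹ * altProd y x m = altProd y x (n + m) := by
  induction n generalizing x y m with
  | zero => right; simp [altProd]
  | succ n ih =>
    have : (altProd x y (n + 1))⁻¹ * altProd y x m = (altProd y x n)⁻¹ * altProd x y (m + 1) := by
      rw [altProd, altProd, mul_inv_rev, inv_eq_of_mul_eq_one_left hx, mul_assoc]
    rw [this, show n + 1 + m = n + (m + 1) by ring]
    exact (ih hy hx (m + 1)).symm

/-- The relator is an alternating word with `2k` letters, cut here into `k + 1` and `k - 1`. -/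
theorem altProd_eq_of_pow_eq_one {G : Type*} [Group G] {x y : G} (hx : x * x = 1)
    (hy : y * y = 1) {k : ℕ} (hk : 1 ≤ k) (hxy : (x * y) ^ k = 1) (hyx : (y * x) ^ k = 1) :
    altProd x y (k + 1) = altProd y x (k - 1) := by
  have h := altProd_inv_mul hx hy (k + 1) (k - 1)
  rw [show k + 1 + (k - 1) = 2 * k by omega, altProd_two_mul, altProd_two_mul, hxy, hyx,
    or_self] at h
  exact inv_mul_eq_one.1 h

/-- The sequence `0, 1, 2c, 4c² - 1, …` of (shifted) Chebyshev polynomials of the second kind. -/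
def chebSeq (c : ℝ) : ℕ → ℝ
  | 0 => 0
  | 1 => 1
  | n + 2 => 2 * c * chebSeq c (n + 1) - chebSeq c n

theorem sin_mul_chebSeq (θ : ℝ) (n : ℕ) :
    Real.sin θ * chebSeq (Real.cos θ) n = Real.sin (n * θ) := by
  induction n using Nat.twoStepInduction with
  | zero => simp [chebSeq]
  | one => simp [chebSeq]
  | more n h0 h1 =>
    have e2 : ((n + 2 : ℕ) : ℝ) * θ = ((n + 1 : ℕ) : ℝ) * θ + θ := by push_cast; ring
    have e0 : (n : ℝ) * θ = ((n + 1 : ℕ) : ℝ) * θ - θ := by push_cast; ring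
    rw [chebSeq, mul_sub, h0, mul_left_comm, h1, e2, e0, Real.sin_add, Real.sin_sub]
    ring

theorem chebSeq_nonneg_of_one_le {c : ℝ} (hc : 1 ≤ c) (n : ℕ) : 0 ≤ chebSeq c n := by
  suffices 0 ≤ chebSeq c n ∧ chebSeq c n ≤ chebSeq c (n + 1) from this.1
  induction n with
  | zero => simp [chebSeq]
  | succ n ih =>
    refine ⟨ih.1.trans ih.2, ?_⟩
    rw [chebSeq]
    nlinarith

theorem sin_pi_div_pos {k : ℕ} (hk : 2 ≤ k) : 0 < Real.sin (Real.pi / k) := by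
  have hk' : (2 : ℝ) ≤ k := by exact_mod_cast hk
  apply Real.sin_pos_of_pos_of_lt_pi
  · have := Real.pi_pos
    positivity
  · rw [div_lt_iff₀ (by linarith)]
    nlinarith [Real.pi_pos]

theorem chebSeq_nonneg_of_le {k : ℕ} (hk : 2 ≤ k) {n : ℕ} (hn : n ≤ k) :
    0 ≤ chebSeq (Real.cos (Real.pi / k)) n := by
  have hk' : (2 : ℝ) ≤ k := by exact_mod_cast hk
  have hn' : (n : ℝ) ≤ k := by exact_mod_cast hn
  have h := sin_mul_chebSeq (Real.pi / k) n
  have hpi := Real.pi_pos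
  have h0 : 0 ≤ Real.sin (n * (Real.pi / k)) := by
    apply Real.sin_nonneg_of_nonneg_of_le_pi
    · positivity
    · rw [← mul_div_assoc, div_le_iff₀ (by linarith)]
      nlinarith
  rw [← h] at h0
  exact nonneg_of_mul_nonneg_right h0 (sin_pi_div_pos hk)

theorem chebSeq_two_mul {k : ℕ} (hk : 2 ≤ k) :
    chebSeq (Real.cos (Real.pi / k)) (2 * k) = 0 ∧
      chebSeq (Real.cos (Real.pi / k)) (2 * k + 1) = 1 := by
  have hs := sin_pi_div_pos hk
  have hk0 : (k : ℝ) ≠ 0 := by positivity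
  constructor
  · apply mul_left_cancel₀ hs.ne'
    rw [sin_mul_chebSeq, mul_zero, show ((2 * k : ℕ) : ℝ) * (Real.pi / k) = 2 * Real.pi by
      push_cast; field_simp]
    exact Real.sin_two_pi
  · apply mul_left_cancel₀ hs.ne'
    rw [sin_mul_chebSeq, mul_one, show ((2 * k + 1 : ℕ) : ℝ) * (Real.pi / k) =
      Real.pi / k + 2 * Real.pi by push_cast; field_simp; ring]
    exact Real.sin_add_two_pi _

variable {V : Type*} [AddCommGroup V] [Module ℝ V] {B : LinearMap.BilinForm ℝ V}

theorem bReflection_mul_pow_apply (hB : ∀ x y, B x y = B y x) {a b : V} (ha : B a a = 1)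
    (hb : B b b = 1) {c : ℝ} (hab : B a b = -c) (n : ℕ) :
    ((bReflection B a * bReflection B b) ^ n) a =
      chebSeq c (2 * n + 1) • a + chebSeq c (2 * n) • b := by
  induction n with
  | zero => simp [chebSeq]
  | succ n ih =>
    have hba : B b a = -c := hB a b ▸ hab
    rw [pow_succ', Module.End.mul_apply, ih, Module.End.mul_apply,
      show 2 * (n + 1) = 2 * n + 2 from rfl]
    simp only [bReflection_apply_of_unit ha, bReflection_apply_of_unit hb, map_add, map_sub,
      map_smul, ha, hb, hab, hba, smul_eq_mul, chebSeq]
    module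

/-- The product of two reflections whose roots form an angle `π - π / k` has order dividing `k`. -/
theorem bReflection_mul_pow_eq_one (hB : ∀ x y, B x y = B y x) {a b : V} (ha : B a a = 1)
    (hb : B b b = 1) {k : ℕ} (hk : 2 ≤ k) (hab : B a b = -Real.cos (Real.pi / k)) :
    (bReflection B a * bReflection B b) ^ k = 1 := by
  set c := Real.cos (Real.pi / k)
  have hba : B b a = -c := hB a b ▸ hab
  obtain ⟨h0, h1⟩ := chebSeq_two_mul hk
  have hra : bReflection B a * bReflection B a = 1 :=
    LinearMap.ext (bReflection_bReflection ha)
  have hrb : bReflection B b * bReflection B b = 1 :=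
    LinearMap.ext (bReflection_bReflection hb)
  have hfa : ((bReflection B a * bReflection B b) ^ k) a = a := by
    rw [bReflection_mul_pow_apply hB ha hb hab, h0, h1, one_smul, zero_smul, add_zero]
  -- The coefficient formula with `a` and `b` exchanged shows that the inverse power fixes `b`.
  have hfb : ((bReflection B a * bReflection B b) ^ k) b = b := by
    have hinv : (bReflection B a * bReflection B b) ^ k *
        (bReflection B b * bReflection B a) ^ k = 1 := by
      have hc1 : (bReflection B a * bReflection B b) * (bReflection B b * bReflection B a) = 1 := by
        rw [mul_assoc, ← mul_assoc (bReflection B b), hrb, one_mul, hra]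
      have hc2 : (bReflection B b * bReflection B a) * (bReflection B a * bReflection B b) = 1 := by
        rw [mul_assoc, ← mul_assoc (bReflection B a), hra, one_mul, hrb]
      rw [← (show Commute _ _ from hc1.trans hc2.symm).mul_pow, hc1, one_pow]
    have hgb : ((bReflection B b * bReflection B a) ^ k) b = b := by
      rw [bReflection_mul_pow_apply hB hb ha hba, h0, h1, one_smul, zero_smul, add_zero]
    have := LinearMap.congr_fun hinv b
    rwa [Module.End.mul_apply, hgb] at this
  have hs := sin_pi_div_pos hk
  have hsc := Real.sin_sq_add_cos_sq (Real.pi / k)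
  have hD : 1 - c ^ 2 ≠ 0 := by
    have : 1 - c ^ 2 = Real.sin (Real.pi / k) ^ 2 := by linarith
    rw [this]
    positivity
  refine LinearMap.ext fun v => ?_
  -- `l` and `m` solve the Gram system of `a, b`, whose determinant is `1 - c² = sin²(π/k) ≠ 0`; so
  -- `u` is orthogonal to both and fixed by both reflections.
  set l := (B a v + c * B b v) / (1 - c ^ 2) with hl
  set m := (B b v + c * B a v) / (1 - c ^ 2) with hm
  set u := v - l • a - m • b with hu
  have hua : B a u = 0 := by
    simp only [hu, map_sub, map_smul, ha, hab, smul_eq_mul, hl, hm]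
    field_simp
    ring
  have hub : B b u = 0 := by
    simp only [hu, map_sub, map_smul, hb, hba, smul_eq_mul, hl, hm]
    field_simp
    ring
  have hfu : ((bReflection B a * bReflection B b) ^ k) u = u := by
    have h1 : (bReflection B a * bReflection B b) u = u := by
      simp [Module.End.mul_apply, bReflection_apply, hua, hub]
    rw [Module.End.pow_apply]
    exact Function.iterate_fixed h1 k
  have hv : v = u + l • a + m • b := by rw [hu]; module
  rw [Module.End.one_apply, hv, map_add, map_add, map_smul, map_smul, hfu, hfa, hfb]

end Alternating

/-! ### Every root is positive or negative. -/

namespace GeometricRepresentation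

variable {I W V : Type*} [Group W] {M : CoxeterMatrix I} {cs : CoxeterSystem M W}
  [AddCommGroup V] [Module ℝ V] (ρ : GeometricRepresentation cs V)

theorem simpleRoot_mem_hull (i : I) : ρ.simpleRoot i ∈ PointedCone.hull ℝ ρ.simples :=
  Submodule.subset_span (Set.mem_range_self i)

theorem rep_simple_apply (i : I) (v : V) :
    ρ.rep (cs.simple i) v = v - (2 * ρ.form (ρ.simpleRoot i) v) • ρ.simpleRoot i := by
  rw [ρ.rep_simple, bReflection_apply_of_unit (ρ.isSimpleSystem.diag i)]

/-- The relation is read off from `B` through faithfulness rather than from the Coxeter matrix. -/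
theorem simple_mul_pow_eq_one {i j : I} {k : ℕ} (hk : 2 ≤ k)
    (hij : ρ.form (ρ.simpleRoot i) (ρ.simpleRoot j) = -Real.cos (Real.pi / k)) :
    (cs.simple i * cs.simple j) ^ k = 1 := by
  apply ρ.faithful
  rw [map_pow, map_mul, ρ.rep_simple, ρ.rep_simple, map_one]
  exact bReflection_mul_pow_eq_one ρ.form_symm (ρ.isSimpleSystem.diag i)
    (ρ.isSimpleSystem.diag j) hk hij

theorem length_altProd_le {i j : I} {k : ℕ} (hk : 2 ≤ k)
    (hij : ρ.form (ρ.simpleRoot i) (ρ.simpleRoot j) = -Real.cos (Real.pi / k)) {n : ℕ}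
    (hn : k + 1 ≤ n) : cs.length (altProd (cs.simple i) (cs.simple j) n) + 2 ≤ n := by
  have hle : ∀ (x y : I) (m : ℕ), cs.length (altProd (cs.simple x) (cs.simple y) m) ≤ m := by
    intro x y m
    induction m generalizing x y with
    | zero => simp [altProd]
    | succ m ih =>
      rw [altProd]
      refine (cs.length_mul_le _ _).trans ?_
      rw [cs.length_simple]
      have := ih y x
      omega
  induction n, hn using Nat.le_induction generalizing i j with
  | base =>
    have hji := ρ.form_symm _ _ ▸ hij
    rw [altProd_eq_of_pow_eq_one (cs.simple_mul_simple_self i) (cs.simple_mul_simple_self j)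
      (by omega) (ρ.simple_mul_pow_eq_one hk hij) (ρ.simple_mul_pow_eq_one hk hji)]
    have := hle j i (k - 1)
    omega
  | succ n hn ih =>
    have := ih (ρ.form_symm _ _ ▸ hij)
    rw [altProd]
    have h2 := cs.length_mul_le (cs.simple i) (altProd (cs.simple j) (cs.simple i) n)
    rw [cs.length_simple] at h2
    omega

/-- If `B = -cos(π/k)`, a reduced alternating word has at most `k` letters, and the coefficients
only turn negative beyond `k`; if `B ≤ -1`, they never do. -/
theorem chebSeq_nonneg_of_reduced {i j : I} (hij : i ≠ j) {n : ℕ} {u : W}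
    (hu : cs.length (u * altProd (cs.simple i) (cs.simple j) n) = cs.length u + n) :
    0 ≤ chebSeq (-ρ.form (ρ.simpleRoot i) (ρ.simpleRoot j)) n := by
  rcases ρ.isSimpleSystem.off_diag i j hij with h | ⟨k, hk, h⟩
  · exact chebSeq_nonneg_of_one_le (by linarith) n
  · rw [h, neg_neg]
    refine chebSeq_nonneg_of_le hk ?_
    by_contra! hlt
    have h1 := ρ.length_altProd_le hk h hlt
    have h2 := cs.length_mul_le u (altProd (cs.simple i) (cs.simple j) n)
    omega

/-- If `l(w s) > l(w)`, then `w(α_s)` is a non-negative combination of the simple roots. -/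
theorem rep_simpleRoot_mem_hull (w : W) (i : I) (hw : cs.length w < cs.length (w * cs.simple i)) :
    ρ.rep w (ρ.simpleRoot i) ∈ PointedCone.hull ℝ ρ.simples := by
  induction hN : cs.length w using Nat.strong_induction_on generalizing w i with
  | _ N IH =>
  subst hN
  -- Right descents in `{x, y}` are stripped off `u` alternately, and the vector is rewritten with
  -- the next Chebyshev coefficients. Once `u` has no such descent, the outer induction makes
  -- `u(α_x)` and `u(α_y)` nonnegative.
  have strip : ∀ (m : ℕ) (u : W) (x y : I) (n : ℕ), cs.length u = m → m < cs.length w → x ≠ y →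
      cs.length (u * altProd (cs.simple x) (cs.simple y) (n + 1)) = cs.length u + (n + 1) →
      cs.length u < cs.length (u * cs.simple x) →
      0 ≤ chebSeq (-ρ.form (ρ.simpleRoot x) (ρ.simpleRoot y)) n →
      ρ.rep u (chebSeq (-ρ.form (ρ.simpleRoot x) (ρ.simpleRoot y)) (n + 1) • ρ.simpleRoot x +
        chebSeq (-ρ.form (ρ.simpleRoot x) (ρ.simpleRoot y)) n • ρ.simpleRoot y) ∈
        PointedCone.hull ℝ ρ.simples := by
    intro m
    induction m using Nat.strong_induction_on with
    | _ m ih =>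
    intro u x y n hu hm hxy hred hux hn
    set c := -ρ.form (ρ.simpleRoot x) (ρ.simpleRoot y) with hc
    have hn1 : 0 ≤ chebSeq c (n + 1) := ρ.chebSeq_nonneg_of_reduced hxy hred
    rcases cs.length_mul_simple u y with huy | huy
    · rw [map_add, map_smul, map_smul]
      exact add_mem (PointedCone.smul_mem _ hn1 (IH _ (hu ▸ hm) u x hux rfl))
        (PointedCone.smul_mem _ hn (IH _ (hu ▸ hm) u y (by omega) rfl))
    · have hyx : ρ.form (ρ.simpleRoot y) (ρ.simpleRoot x) = -c := by
        rw [hc, neg_neg, ρ.form_symm]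
      have huyy : u * cs.simple y * cs.simple y = u := by
        rw [mul_assoc, cs.simple_mul_simple_self, mul_one]
      have hstep := ih (m - 1) (by omega) (u * cs.simple y) y x (n + 1) (by omega) (by omega)
        hxy.symm
        (by rw [altProd, ← mul_assoc, huyy, hred]; omega) (by rw [huyy]; omega)
        (by rwa [hyx, neg_neg])
      rw [hyx, neg_neg] at hstep
      rw [← huyy, map_mul, Module.End.mul_apply]
      convert hstep using 2
      rw [ρ.rep_simple_apply, map_add, map_smul, map_smul, hyx, ρ.isSimpleSystem.diag, chebSeq,
        smul_eq_mul, smul_eq_mul]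
      module
  by_cases h1 : w = 1
  · rw [h1, map_one, Module.End.one_apply]
    exact ρ.simpleRoot_mem_hull i
  obtain ⟨j, hj⟩ := cs.exists_rightDescent_of_ne_one h1
  have hij : j ≠ i := fun h => by
    subst h
    exact lt_asymm hw hj
  have hjlt : cs.length (w * cs.simple j) < cs.length w := hj
  have hj1 := cs.isRightDescent_iff.1 hj
  have hi1 := cs.length_mul_simple w i
  have hwjj : w * cs.simple j * cs.simple j = w := by
    rw [mul_assoc, cs.simple_mul_simple_self, mul_one]
  -- Start: `w(α_i) = (w s_j)(2c α_j + α_i)`, whose coefficients are the terms `2` and `1` of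
  -- `chebSeq`.
  have hstep := strip _ (w * cs.simple j) j i 1 rfl hjlt hij
    (by
      rw [altProd, altProd, altProd, mul_one, ← mul_assoc, hwjj]
      omega)
    (by rwa [hwjj]) (by simp [chebSeq])
  rw [← hwjj, map_mul, Module.End.mul_apply]
  convert hstep using 2
  simp only [ρ.rep_simple_apply, chebSeq]
  module

theorem form_self_of_mem_roots {β : V} (hβ : β ∈ ρ.roots) : ρ.form β β = 1 := by
  obtain ⟨w, _, ⟨i, rfl⟩, rfl⟩ := hβ
  rw [ρ.isometry, ρ.isSimpleSystem.diag]

theorem rep_mem_roots (w : W) {β : V} (hβ : β ∈ ρ.roots) : ρ.rep w β ∈ ρ.roots := by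
  obtain ⟨v, α, hα, rfl⟩ := hβ
  exact ⟨w * v, α, hα, by rw [map_mul, Module.End.mul_apply]⟩

theorem simpleRoot_mem_roots (i : I) : ρ.simpleRoot i ∈ ρ.roots :=
  ⟨1, _, ⟨i, rfl⟩, by rw [map_one, Module.End.one_apply]⟩

theorem rep_simple_simpleRoot (i : I) : ρ.rep (cs.simple i) (ρ.simpleRoot i) = -ρ.simpleRoot i := by
  rw [ρ.rep_simple, bReflection_self (ρ.isSimpleSystem.diag i)]

theorem rep_simple_rep_simple (i : I) (v : V) :
    ρ.rep (cs.simple i) (ρ.rep (cs.simple i) v) = v := by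
  rw [← Module.End.mul_apply, ← map_mul, cs.simple_mul_simple_self, map_one, Module.End.one_apply]

theorem neg_mem_roots {β : V} (hβ : β ∈ ρ.roots) : -β ∈ ρ.roots := by
  obtain ⟨w, _, ⟨i, rfl⟩, rfl⟩ := hβ
  rw [← map_neg, ← ρ.rep_simple_simpleRoot]
  exact ρ.rep_mem_roots _ (ρ.rep_mem_roots _ (ρ.simpleRoot_mem_roots i))

theorem simpleRoot_mem_posRoots (i : I) : ρ.simpleRoot i ∈ posRoots ρ.roots ρ.simples :=
  ⟨ρ.simpleRoot_mem_roots i, ρ.simpleRoot_mem_hull i⟩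

/-- `w(α_i)` and `(w s_i)(α_i)` are opposite, and `s_i` is a right ascent of one of `w`, `w s_i`. -/
theorem pos_or_neg {β : V} (hβ : β ∈ ρ.roots) :
    β ∈ posRoots ρ.roots ρ.simples ∨ -β ∈ posRoots ρ.roots ρ.simples := by
  have hnβ := ρ.neg_mem_roots hβ
  refine Or.imp (And.intro hβ) (And.intro hnβ) ?_
  obtain ⟨w, _, ⟨i, rfl⟩, rfl⟩ := hβ
  rcases cs.length_mul_simple w i with h | h
  · exact .inl (ρ.rep_simpleRoot_mem_hull w i (by omega))
  · right
    have hw : w * cs.simple i * cs.simple i = w := by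
      rw [mul_assoc, cs.simple_mul_simple_self, mul_one]
    have := ρ.rep_simpleRoot_mem_hull (w * cs.simple i) i (by rw [hw]; omega)
    rwa [map_mul, Module.End.mul_apply, ρ.rep_simple_simpleRoot, map_neg] at this

/-- Every root gives rise to a reflection in `W`. -/
theorem exists_rep_eq_bReflection {β : V} (hβ : β ∈ ρ.roots) :
    ∃ t, ρ.rep t = bReflection ρ.form β := by
  obtain ⟨w, _, ⟨i, rfl⟩, rfl⟩ := hβ
  refine ⟨w * cs.simple i * w⁻¹, LinearMap.ext fun v => ?_⟩
  have hv : ρ.rep w (ρ.rep w⁻¹ v) = v := by simp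
  rw [map_mul, map_mul, Module.End.mul_apply, Module.End.mul_apply, ρ.rep_simple_apply,
    bReflection_apply_of_unit (by rw [ρ.isometry, ρ.isSimpleSystem.diag]), map_sub, map_smul, hv,
    ← ρ.isometry w, hv]

theorem mem_hull_iff [Fintype I] {v : V} :
    v ∈ PointedCone.hull ℝ ρ.simples ↔
      ∃ c : I → ℝ, (∀ i, 0 ≤ c i) ∧ ∑ i, c i • ρ.simpleRoot i = v := by
  rw [PointedCone.hull, simples, Submodule.mem_span_range_iff_exists_fun]
  constructor
  · rintro ⟨c, rfl⟩
    exact ⟨fun i => c i, fun i => (c i).2, rfl⟩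
  · rintro ⟨c, hc, rfl⟩
    exact ⟨fun i => ⟨c i, hc i⟩, rfl⟩

theorem eq_zero_of_sum_eq_zero [Fintype I] {c : I → ℝ} (hc : ∀ i, 0 ≤ c i)
    (h : ∑ i, c i • ρ.simpleRoot i = 0) (i : I) : c i = 0 := by
  have := ρ.isSimpleSystem.pos_indep (Finsupp.equivFunOnFinite.symm c) hc
    ((Finsupp.sum_fintype _ _ fun i => zero_smul ℝ (ρ.simpleRoot i)).trans h)
  exact DFunLike.congr_fun this i

theorem form_simpleRoot_nonpos {i j : I} (hij : i ≠ j) :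
    ρ.form (ρ.simpleRoot i) (ρ.simpleRoot j) ≤ 0 := by
  rcases ρ.isSimpleSystem.off_diag i j hij with h | ⟨k, hk, h⟩
  · linarith
  · rw [h, neg_nonpos]
    have hk' : (2 : ℝ) ≤ k := by exact_mod_cast hk
    have hpi := Real.pi_pos
    refine Real.cos_nonneg_of_neg_pi_div_two_le_of_le ?_ ?_
    · have : 0 ≤ Real.pi / k := by positivity
      linarith
    · exact div_le_div_of_nonneg_left hpi.le (by norm_num) hk'

theorem ne_zero_of_mem_roots {β : V} (hβ : β ∈ ρ.roots) : β ≠ 0 := by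
  rintro rfl
  simpa using ρ.form_self_of_mem_roots hβ

/-! ### Disjointness of signs and finiteness of inversion sets. -/

variable [Finite I]

theorem not_neg_mem_hull {β : V} (hβ : β ∈ PointedCone.hull ℝ ρ.simples) (h0 : β ≠ 0) :
    -β ∉ PointedCone.hull ℝ ρ.simples := by
  have := Fintype.ofFinite I
  intro hn
  obtain ⟨c, hc, rfl⟩ := ρ.mem_hull_iff.1 hβ
  obtain ⟨d, hd, hcd⟩ := ρ.mem_hull_iff.1 hn
  refine h0 (Finset.sum_eq_zero fun i _ => ?_)
  have := ρ.eq_zero_of_sum_eq_zero (c := fun i => c i + d i)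
    (fun i => add_nonneg (hc i) (hd i))
    (by simp only [add_smul, Finset.sum_add_distrib]; rw [hcd, add_neg_cancel]) i
  rw [show c i = 0 by linarith [hc i, hd i], zero_smul]

theorem not_neg {β : V} (hβ : β ∈ posRoots ρ.roots ρ.simples) :
    -β ∉ posRoots ρ.roots ρ.simples := fun h =>
  ρ.not_neg_mem_hull hβ.2 (ρ.ne_zero_of_mem_roots hβ.1) h.2

/-- Each simple root spans an extreme ray of the cone of the simple roots. -/
theorem eq_smul_of_add_eq_smul_simpleRoot {x y : V} (hx : x ∈ PointedCone.hull ℝ ρ.simples)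
    (hy : y ∈ PointedCone.hull ℝ ρ.simples) {r : ℝ} {i : I} (hxy : x + y = r • ρ.simpleRoot i) :
    ∃ s : ℝ, 0 ≤ s ∧ x = s • ρ.simpleRoot i := by
  classical
  have := Fintype.ofFinite I
  obtain ⟨c, hc, rfl⟩ := ρ.mem_hull_iff.1 hx
  obtain ⟨d, hd, rfl⟩ := ρ.mem_hull_iff.1 hy
  refine ⟨c i, hc i, ?_⟩
  set e : I → ℝ := fun j => c j + d j
  have he : ∀ j, 0 ≤ e j := fun j => add_nonneg (hc j) (hd j)
  have hsum : ∑ j, e j • ρ.simpleRoot j = r • ρ.simpleRoot i := by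
    simpa only [e, add_smul, Finset.sum_add_distrib] using hxy
  -- Simple roots may be linearly dependent, so coefficients cannot be compared directly. With `a =
  -- 0`, pairing with `α_i` yields `r ≤ e i`; then `a = e i - r` gives a nonnegative relation, which
  -- must be trivial.
  have hupd : ∀ a : ℝ, ∑ j, Function.update e i a j • ρ.simpleRoot j =
      (a - e i + r) • ρ.simpleRoot i := by
    intro a
    rw [← Finset.add_sum_erase _ _ (Finset.mem_univ i)] at hsum ⊢
    rw [Function.update_self, Finset.sum_congr rfl fun j hj => by
      rw [Function.update_of_ne (Finset.ne_of_mem_erase hj)], eq_sub_of_add_eq' hsum]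
    module
  have hri : r ≤ e i := by
    have h1 := congrArg (ρ.form (ρ.simpleRoot i)) (hupd 0)
    rw [map_sum, map_smul, ρ.isSimpleSystem.diag, smul_eq_mul, mul_one] at h1
    have h2 : ∑ j, ρ.form (ρ.simpleRoot i) (Function.update e i 0 j • ρ.simpleRoot j) ≤ 0 := by
      refine Finset.sum_nonpos fun j _ => ?_
      rw [map_smul, smul_eq_mul]
      by_cases hji : j = i
      · subst hji
        simp
      · rw [Function.update_of_ne hji]
        exact mul_nonpos_of_nonneg_of_nonpos (he j) (ρ.form_simpleRoot_nonpos (Ne.symm hji))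
    linarith
  have hz := ρ.eq_zero_of_sum_eq_zero (c := Function.update e i (e i - r)) (fun j => by
      by_cases hji : j = i
      · subst hji
        simpa using hri
      · rw [Function.update_of_ne hji]
        exact he j) (by rw [hupd, sub_sub_cancel_left, neg_add_cancel, zero_smul])
  refine Finset.sum_eq_single i (fun j _ hji => ?_) (by simp)
  have := hz j
  rw [Function.update_of_ne hji] at this
  rw [show c j = 0 by linarith [hc j, hd j, show e j = c j + d j from rfl], zero_smul]

/-- A simple reflection permutes the positive roots other than its own simple root. -/
theorem rep_simple_mem_posRoots {i : I} {β : V} (hβ : β ∈ posRoots ρ.roots ρ.simples)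
    (hne : β ≠ ρ.simpleRoot i) : ρ.rep (cs.simple i) β ∈ posRoots ρ.roots ρ.simples := by
  refine (ρ.pos_or_neg (ρ.rep_mem_roots _ hβ.1)).resolve_right fun hneg => hne ?_
  -- If `s_i β` were negative, `β + (-s_i β)` would be a multiple of `α_i` with both summands in the
  -- cone.
  obtain ⟨s, hs, hβs⟩ := ρ.eq_smul_of_add_eq_smul_simpleRoot (i := i)
    (r := 2 * ρ.form (ρ.simpleRoot i) β) hβ.2 hneg.2
    (by rw [ρ.rep_simple_apply]; module)
  have h1 := ρ.form_self_of_mem_roots hβ.1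
  rw [hβs, map_smul, LinearMap.map_smul₂, ρ.isSimpleSystem.diag] at h1
  simp only [smul_eq_mul, mul_one] at h1
  rw [hβs, show s = 1 by nlinarith, one_smul]

/-- Right multiplication by `s_i` moves the inversions by `s_i` and can add only `α_i`. -/
theorem finite_inversions (w : W) :
    {δ | δ ∈ posRoots ρ.roots ρ.simples ∧ -ρ.rep w δ ∈ posRoots ρ.roots ρ.simples}.Finite := by
  induction w using cs.simple_induction_right with
  | one =>
    refine Set.finite_empty.subset fun δ hδ => ρ.not_neg hδ.1 ?_
    simpa using hδ.2
  | mul_simple_right w i ih =>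
    refine ((Set.finite_singleton (ρ.simpleRoot i)).union
      (ih.image (ρ.rep (cs.simple i)))).subset fun δ hδ => ?_
    by_cases he : δ = ρ.simpleRoot i
    · exact .inl he
    · refine .inr ⟨ρ.rep (cs.simple i) δ, ⟨ρ.rep_simple_mem_posRoots hδ.1 he, ?_⟩,
        ρ.rep_simple_rep_simple i δ⟩
      have := hδ.2
      rwa [map_mul, Module.End.mul_apply] at this

theorem isSignedRootSystem : IsSignedRootSystem ρ.form ρ.roots ρ.simples where
  symm := ρ.form_symm
  norm _ := ρ.form_self_of_mem_roots
  pos_or_neg _ := ρ.pos_or_neg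
  not_neg _ := ρ.not_neg
  refl_mem γ hγ β hβ := by
    obtain ⟨t, ht⟩ := ρ.exists_rep_eq_bReflection hγ
    exact ht ▸ ρ.rep_mem_roots t hβ
  finite γ hγ := by
    obtain ⟨t, ht⟩ := ρ.exists_rep_eq_bReflection hγ
    refine (ρ.finite_inversions t).subset fun δ hδ => ?_
    rw [Set.mem_ofPred_eq, ht]
    exact (mem_inversionSet_bReflection (ρ.form_self_of_mem_roots hγ)).1 hδ

end GeometricRepresentation

/-! ### Canonical simple systems and the positive roots of reflection subgroups. -/

theorem map_mem_hull {V : Type*} [AddCommGroup V] [Module ℝ V] {S T : Set V} (f : V →ₗ[ℝ] V)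
    (hf : ∀ v ∈ S, f v ∈ PointedCone.hull ℝ T) {v : V} (hv : v ∈ PointedCone.hull ℝ S) :
    f v ∈ PointedCone.hull ℝ T := by
  induction hv using Submodule.span_induction with
  | mem v hv => exact hf v hv
  | zero => simp
  | add v w _ _ ihv ihw => simpa using add_mem ihv ihw
  | smul r v _ ih => simpa [NNReal.smul_def] using Submodule.smul_mem _ r ih

namespace GeometricRepresentation

variable {I W V : Type*} [Group W] {M : CoxeterMatrix I} {cs : CoxeterSystem M W}
  [AddCommGroup V] [Module ℝ V] (ρ : GeometricRepresentation cs V)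

/-- The canonical simple system of a set `Ψ` of roots that is stable under its reflections. -/
def canonicalSimples (Ψ : Set V) : Set V :=
  {α | α ∈ posRoots ρ.roots ρ.simples ∧
    inversionSet ρ.roots ρ.simples (bReflection ρ.form α) ∩ Ψ = {α}}

theorem mem_canonicalSimples_iff {Ψ : Set V} {α : V} :
    α ∈ ρ.canonicalSimples Ψ ↔ α ∈ posRoots ρ.roots ρ.simples ∧ α ∈ Ψ ∧
      ∀ δ ∈ posRoots ρ.roots ρ.simples, δ ∈ Ψ →
        -bReflection ρ.form α δ ∈ posRoots ρ.roots ρ.simples → δ = α := by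
  refine and_congr_right fun hα => ?_
  have hα1 := ρ.form_self_of_mem_roots hα.1
  rw [Set.eq_singleton_iff_unique_mem]
  refine and_congr ⟨fun h => h.2, fun h => ⟨?_, h⟩⟩ ?_
  · rw [mem_inversionSet_bReflection hα1, bReflection_self hα1, neg_neg]
    exact ⟨hα, hα⟩
  · simp only [Set.mem_inter_iff, mem_inversionSet_bReflection hα1]
    exact ⟨fun h δ h1 h2 h3 => h δ ⟨⟨h1, h3⟩, h2⟩, fun h δ hδ => h δ hδ.1.1 hδ.2 hδ.1.2⟩

theorem bReflection_mem_subRoots {W' : Subgroup W} {γ β : V} (hγ : γ ∈ ρ.subRoots W')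
    (hβ : β ∈ ρ.subRoots W') : bReflection ρ.form γ β ∈ ρ.subRoots W' := by
  obtain ⟨hγΦ, t, ht, hrt⟩ := hγ
  obtain ⟨hβΦ, u, hu, hru⟩ := hβ
  refine ⟨hrt ▸ ρ.rep_mem_roots t hβΦ, t * u * t, mul_mem (mul_mem ht hu) ht, ?_⟩
  refine LinearMap.ext fun v => ?_
  rw [bReflection_conj ρ.form_symm (ρ.form_self_of_mem_roots hγΦ) (ρ.form_self_of_mem_roots hβΦ),
    map_mul, map_mul, hrt, hru]
  rfl

variable [Finite I]

theorem simpleRoot_mem_canonicalSimples {Ψ : Set V} {i : I} (hi : ρ.simpleRoot i ∈ Ψ) :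
    ρ.simpleRoot i ∈ ρ.canonicalSimples Ψ := by
  rw [mem_canonicalSimples_iff]
  refine ⟨ρ.simpleRoot_mem_posRoots i, hi, fun δ hδ _ hneg => ?_⟩
  by_contra hne
  rw [← ρ.rep_simple] at hneg
  exact ρ.not_neg (ρ.rep_simple_mem_posRoots hδ hne) hneg

/-- Since `±α_i ∉ Ψ`, conjugation by `s_i` preserves the sign of every root in `Ψ`, hence the
defining condition of canonical simple roots. -/
theorem rep_simple_mem_canonicalSimples {Ψ : Set V}
    (hΨ : ∀ γ ∈ Ψ, ∀ β ∈ Ψ, bReflection ρ.form γ β ∈ Ψ) {i : I} (hi : ρ.simpleRoot i ∉ Ψ) {α : V}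
    (hα : α ∈ ρ.canonicalSimples (ρ.rep (cs.simple i) '' Ψ)) :
    ρ.rep (cs.simple i) α ∈ ρ.canonicalSimples Ψ := by
  have hi1 := ρ.isSimpleSystem.diag i
  have hni : -ρ.simpleRoot i ∉ Ψ := fun h => hi (by
    have := hΨ _ h _ h
    rwa [bReflection_neg, map_neg, bReflection_self hi1, neg_neg] at this)
  rw [mem_canonicalSimples_iff] at hα ⊢
  obtain ⟨hpos, ⟨δ, hδ, rfl⟩, huniq⟩ := hα
  have hδpos : δ ∈ posRoots ρ.roots ρ.simples := by
    rw [← ρ.rep_simple_rep_simple i δ]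
    refine ρ.rep_simple_mem_posRoots hpos fun he => hni ?_
    rwa [← ρ.rep_simple_simpleRoot, ← he, ρ.rep_simple_rep_simple]
  rw [ρ.rep_simple_rep_simple]
  refine ⟨hδpos, hδ, fun ξ hξ hξΨ hneg => ?_⟩
  have hδ1 := ρ.form_self_of_mem_roots hδpos.1
  have key := huniq (ρ.rep (cs.simple i) ξ)
    (ρ.rep_simple_mem_posRoots hξ fun he => hi (he ▸ hξΨ)) ⟨ξ, hξΨ, rfl⟩ (by
      rw [ρ.rep_simple, bReflection_conj ρ.form_symm hi1 hδ1, bReflection_bReflection hi1,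
        ← map_neg, ← ρ.rep_simple]
      refine ρ.rep_simple_mem_posRoots hneg fun he => hni ?_
      rw [← he, neg_neg]
      exact hΨ _ hδ _ hξΨ)
  rw [← ρ.rep_simple_rep_simple i ξ, key, ρ.rep_simple_rep_simple]

/-- The positive elements of a set `Ψ` of roots that is stable under its reflections lie in the
cone of the canonical simple system of `Ψ`. -/
theorem mem_hull_canonicalSimples {Ψ : Set V}
    (hΨ : ∀ γ ∈ Ψ, ∀ β ∈ Ψ, bReflection ρ.form γ β ∈ Ψ) {β : V} (hβ : β ∈ Ψ)
    (hpos : β ∈ posRoots ρ.roots ρ.simples) (w : W)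
    (hw : -ρ.rep w β ∈ posRoots ρ.roots ρ.simples) :
    β ∈ PointedCone.hull ℝ (ρ.canonicalSimples Ψ) := by
  induction hN : cs.length w using Nat.strong_induction_on generalizing w Ψ β with
  | _ N IH =>
  subst hN
  have h1 : w ≠ 1 := by
    rintro rfl
    rw [map_one, Module.End.one_apply] at hw
    exact ρ.not_neg hpos hw
  obtain ⟨i, hi⟩ := cs.exists_rightDescent_of_ne_one h1
  have hlt : cs.length (w * cs.simple i) < cs.length w := hi
  have hwii : w * cs.simple i * cs.simple i = w := by
    rw [mul_assoc, cs.simple_mul_simple_self, mul_one]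
  by_cases hβi : β = ρ.simpleRoot i
  · subst hβi
    exact Submodule.subset_span (ρ.simpleRoot_mem_canonicalSimples hβ)
  have hpos' := ρ.rep_simple_mem_posRoots hpos hβi
  have hw' : -ρ.rep (w * cs.simple i) (ρ.rep (cs.simple i) β) ∈ posRoots ρ.roots ρ.simples := by
    rwa [← Module.End.mul_apply, ← map_mul, hwii]
  by_cases hiΨ : ρ.simpleRoot i ∈ Ψ
  · rcases ρ.pos_or_neg (ρ.rep_mem_roots (w * cs.simple i) hpos.1) with hp | hn
    · have hform : 0 < ρ.form (ρ.simpleRoot i) β := by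
        by_contra! hle
        refine ρ.not_neg hw' ?_
        rw [neg_neg]
        refine ⟨ρ.rep_mem_roots _ hpos'.1, ?_⟩
        rw [ρ.rep_simple_apply, map_sub, map_smul, sub_eq_add_neg, ← neg_smul]
        refine add_mem hp.2 (PointedCone.smul_mem _ (by linarith) ?_)
        exact ρ.rep_simpleRoot_mem_hull _ i (by rwa [hwii])
      have hmem : ρ.rep (cs.simple i) β ∈ Ψ := by
        rw [ρ.rep_simple]
        exact hΨ _ hiΨ _ hβ
      have hsum : β = ρ.rep (cs.simple i) β +
          (2 * ρ.form (ρ.simpleRoot i) β) • ρ.simpleRoot i := by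
        rw [ρ.rep_simple_apply]
        module
      rw [hsum]
      exact add_mem (IH _ hlt hΨ hmem hpos' _ hw' rfl) (PointedCone.smul_mem _ (by linarith)
        (Submodule.subset_span (ρ.simpleRoot_mem_canonicalSimples hiΨ)))
    · exact IH _ hlt hΨ hβ hpos _ hn rfl
  -- When `α_i ∉ Ψ`, the induction passes to `s_i Ψ`, `s_i β` and the shorter `w s_i`; this is why
  -- `Ψ` varies.
  · have hΨ' : ∀ γ ∈ ρ.rep (cs.simple i) '' Ψ, ∀ β ∈ ρ.rep (cs.simple i) '' Ψ,
        bReflection ρ.form γ β ∈ ρ.rep (cs.simple i) '' Ψ := by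
      rintro _ ⟨γ, hγ, rfl⟩ _ ⟨δ, hδ, rfl⟩
      refine ⟨_, hΨ γ hγ δ hδ, ?_⟩
      rw [bReflection_apply, bReflection_apply, ρ.isometry, ρ.isometry, map_sub, map_smul]
    rw [← ρ.rep_simple_rep_simple i β]
    exact map_mem_hull _ (fun α hα => Submodule.subset_span
      (ρ.rep_simple_mem_canonicalSimples hΨ hiΨ hα)) (IH _ hlt hΨ' ⟨β, hβ, rfl⟩ hpos' _ hw' rfl)

/-- The positive roots of a reflection subgroup are its roots that are positive. -/
theorem mem_posRoots_subRoots_iff {W' : Subgroup W} {β : V} :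
    β ∈ posRoots (ρ.subRoots W') (ρ.subSimples W') ↔
      β ∈ ρ.subRoots W' ∧ β ∈ posRoots ρ.roots ρ.simples := by
  refine and_congr_right fun hβ => ⟨fun h => ⟨hβ.1, ?_⟩, fun h => ?_⟩
  · exact map_mem_hull LinearMap.id (fun α hα => hα.1.2) h
  -- The reflection `s_β` itself sends `β` to a negative root, so it starts the induction.
  · obtain ⟨t, -, ht⟩ := hβ.2
    refine ρ.mem_hull_canonicalSimples (fun γ hγ β hβ => ρ.bReflection_mem_subRoots hγ hβ) hβ h t ?_
    rwa [ht, bReflection_self (ρ.form_self_of_mem_roots h.1), neg_neg]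

theorem isSignedRootSystem_subRoots (W' : Subgroup W) :
    IsSignedRootSystem ρ.form (ρ.subRoots W') (ρ.subSimples W') where
  symm := ρ.form_symm
  norm _ hβ := ρ.form_self_of_mem_roots hβ.1
  pos_or_neg β hβ := by
    have hnβ : -β ∈ ρ.subRoots W' := by
      have := ρ.bReflection_mem_subRoots hβ hβ
      rwa [bReflection_self (ρ.form_self_of_mem_roots hβ.1)] at this
    rw [mem_posRoots_subRoots_iff, mem_posRoots_subRoots_iff]
    exact (ρ.pos_or_neg hβ.1).imp (And.intro hβ) (And.intro hnβ)
  not_neg β hβ hnβ := by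
    rw [mem_posRoots_subRoots_iff] at hβ hnβ
    exact ρ.not_neg hβ.2 hnβ.2
  refl_mem _ hγ _ hβ := ρ.bReflection_mem_subRoots hγ hβ
  finite γ hγ := by
    refine (ρ.isSignedRootSystem.finite γ hγ.1).subset fun δ hδ => ?_
    have hγ1 := ρ.form_self_of_mem_roots hγ.1
    rw [mem_inversionSet_bReflection hγ1] at hδ ⊢
    exact ⟨(ρ.mem_posRoots_subRoots_iff.1 hδ.1).2, (ρ.mem_posRoots_subRoots_iff.1 hδ.2).2⟩

end GeometricRepresentation

theorem theorem1p10 {I W V : Type*} [Finite I] [Group W] {M : CoxeterMatrix I}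
    (cs : CoxeterSystem M W) [AddCommGroup V] [Module ℝ V]
    (ρ : GeometricRepresentation cs V) (X : Set ℝ) (hX : IsOrderCoideal X)
    (W' : Subgroup W) (hW' : ρ.IsReflectionSubgroup W') :
    (∀ β ∈ ρ.roots, ∀ β' ∈ ρ.roots,
      BruhatLE ρ.form ρ.roots ρ.simples β β' →
        xLength ρ.form ρ.roots ρ.simples X β ≤ xLength ρ.form ρ.roots ρ.simples X β') ∧
    (∀ β ∈ ρ.subRoots W', ∀ β' ∈ ρ.subRoots W',
      BruhatLE ρ.form (ρ.subRoots W') (ρ.subSimples W') β β' →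
        BruhatLE ρ.form ρ.roots ρ.simples β β' ∧
        0 ≤ xLength ρ.form (ρ.subRoots W') (ρ.subSimples W') X β' -
            xLength ρ.form (ρ.subRoots W') (ρ.subSimples W') X β ∧
        xLength ρ.form (ρ.subRoots W') (ρ.subSimples W') X β' -
            xLength ρ.form (ρ.subRoots W') (ρ.subSimples W') X β ≤
          xLength ρ.form ρ.roots ρ.simples X β' - xLength ρ.form ρ.roots ρ.simples X β) ∧
    (∀ β' ∈ posRoots (ρ.subRoots W') (ρ.subSimples W'),
      0 ≤ xLength ρ.form (ρ.subRoots W') (ρ.subSimples W') X β' ∧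
      xLength ρ.form (ρ.subRoots W') (ρ.subSimples W') X β' ≤
        xLength ρ.form ρ.roots ρ.simples X β') := by
  have h := ρ.isSignedRootSystem
  have h' := ρ.isSignedRootSystem_subRoots W'
  have hsub : posRoots (ρ.subRoots W') (ρ.subSimples W') ⊆ posRoots ρ.roots ρ.simples :=
    fun β hβ => (ρ.mem_posRoots_subRoots_iff.1 hβ).2
  refine ⟨fun β _ β' _ hle => h.xLength_le_of_bruhatLE hX hle, fun β _ β' _ hle => ⟨?_, ?_, ?_⟩,
    fun β' hβ' => h.xLength_le_of_mem_posRoots h' hsub X hβ'⟩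
  · exact h.bruhatLE_of_sub h' hsub hle
  · exact sub_nonneg.2 (h'.xLength_le_of_bruhatLE hX hle)
  · exact h.xLength_sub_le_of_bruhatLE h' hsub hX hle
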